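/- All logarithms are to base $2$; side information systems $E$ are finite-dimensional. **Definitions.** A sub-normalized state is a positive semidefinite operator $\rho$ with $\operatorname{Tr}\rho\le 1$; put $\|A\|_1=\operatorname{Tr}\sqrt{A^\dagger A}$. For a sub-normalized state $\rho_{XE}$ let $$H_{\min}(X|E)_\rho=\sup_{\sigma_E}\sup\{\lambda\in\mathbb R : \rho_{XE}\le 2^{-\lambda}\,\mathbb 1_X\otimes\sigma_E\},$$ where $\sigma_E$ ranges over the states ($\sigma_E\ge 0$, $\operatorname{Tr}\sigma_E=1$), and for $\epsilon\ge 0$ let $H_{\min}^{\epsilon}(X|E)_\rho$ be the supremum of $H_{\min}(X|E)_{\tilde\rho}$ over all sub-normalized states $\tilde\rho_{XE}$ with $D(\tilde\rho,\rho)\le\epsilon$, where $D(\rho,\sigma)=\sqrt{1-\bigl(\operatorname{Tr}|\sqrt\rho\sqrt\sigma|+\sqrt{(1-\operatorname{Tr}\rho)(1-\operatorname{Tr}\sigma)}\bigr)^2}$ is the purified distance. Let $\mathcal X,\mathcal Y,\mathcal Z$ be finite sets, with $\mathcal Y,\mathcal Z$ non-empty. A map $\mathrm{EXT}:\mathcal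 X\times\mathcal Y\to\mathcal Z$ is a *quantum-proof $(k,\epsilon_{\mathrm{EXT}})$-strong extractor* if for every sub-normalized classical-quantum state $\rho_{XE}=\sum_{x\in\mathcal X}|x\rangle\langle x|\otimes\rho^x_E$ and every $\epsilon\ge 0$ with $H^{\epsilon}_{\min}(X|E)_\rho\ge k$, the state $\rho_{ZYE}=\frac1{|\mathcal Y|}\sum_{y}\sum_{x}|\mathrm{EXT}(x,y)\rangle\langle \mathrm{EXT}(x,y)|\otimes|y\rangle\langle y|\otimes\rho^x_E$ satisfies $$\tfrac12\bigl\|\rho_{ZYE}-\mu_Z\otimes\mu_Y\otimes\rho_E\bigr\|_1\le\epsilon_{\mathrm{EXT}}+2\epsilon,$$ where $\mu_Z,\mu_Y$ are the maximally mixed states and $\rho_E=\sum_x\rho_E^x$. For $\delta_h\ge 1$, a family $(h_y)_{y\in\mathcal Y}$ of functions $\mathcal X\to\mathcal Z$ is *$\delta_h$-almost two-universal* if $\Pr_y[h_y(x)=h_y(x')]\le\delta_h/|\mathcal Z|$ for all $x\ne x'$, with $y$ uniform on $\mathcal Y$. **Lemma.** Let $k_{\mathrm{EXT}}\in\mathbb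 R$, $\epsilon'>0$, $\epsilon''>0$, $1\le\delta_h<1+4\epsilon''^2$, and let $(h_y)_{y\in\mathcal Y}$ be a $\delta_h$-almost two-universal family of functions $\mathcal X\to\mathcal Z$ whose output length $l=\log|\mathcal Z|$ is $$l=k_{\mathrm{EXT}}-\log\Bigl(1+\frac{2}{\epsilon'^2}\Bigr)-\log\frac{1}{4\epsilon''^2-\delta_h+1}.$$ Then $\mathrm{EXT}(x,y)=h_y(x)$ is a quantum-proof $(k_{\mathrm{EXT}},\epsilon_{\mathrm{EXT}})$-strong extractor with $\epsilon_{\mathrm{EXT}}=\epsilon'+\epsilon''$. -/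

import Mathlib

namespace QExt

noncomputable section

open scoped MatrixOrder Kronecker ComplexOrder

/-- The Schatten 1-norm `‖A‖₁ = Tr √(A† A)` of a square complex matrix. -/
def traceNorm {n : Type*} [Fintype n] [DecidableEq n] (A : Matrix n n ℂ) : ℝ :=
  (CFC.sqrt (A.conjTranspose * A)).trace.re

/-- Sub-normalized states: positive semidefinite matrices of trace at most one. -/
def IsSubState {n : Type*} [Fintype n] (ρ : Matrix n n ℂ) : Prop :=
  ρ.PosSemidef ∧ ρ.trace.re ≤ 1

/-- (Normalized) states: positive semidefinite matrices of trace one. -/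
def IsState {n : Type*} [Fintype n] (ρ : Matrix n n ℂ) : Prop :=
  ρ.PosSemidef ∧ ρ.trace = 1

/-- The purified distance
`D(ρ, σ) = √(1 - (Tr|√ρ √σ| + √((1 - Tr ρ) (1 - Tr σ)))²)` of sub-normalized states. -/
def purifiedDist {n : Type*} [Fintype n] [DecidableEq n] (ρ σ : Matrix n n ℂ) : ℝ :=
  √(1 - (traceNorm (CFC.sqrt ρ * CFC.sqrt σ) + √((1 - ρ.trace.re) * (1 - σ.trace.re))) ^ 2)

/-- The min-entropy `H_min(X|E)_ρ` in bits, as an extended real number (it is `⊤` for `ρ = 0`):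
the supremum over states `σ` on `E` of the supremum of all real `lam` with
`ρ ≤ 2 ^ (-lam) • (1 ⊗ σ)` in the Loewner order. -/
def minEntropy {X E : Type*} [Fintype X] [DecidableEq X] [Fintype E] [DecidableEq E]
    (ρ : Matrix (X × E) (X × E) ℂ) : EReal :=
  ⨆ (σ : Matrix E E ℂ) (_ : IsState σ) (lam : ℝ)
    (_ : ρ ≤ ((2 : ℝ) ^ (-lam)) • Matrix.kronecker (1 : Matrix X X ℂ) σ), (lam : EReal)

/-- The smooth min-entropy: the supremum of the min-entropy over all sub-normalized states
of the joint system (not only classical-quantum ones) in the purified-distance ball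
of radius `ε`. -/
def smoothMinEntropy {X E : Type*} [Fintype X] [DecidableEq X] [Fintype E] [DecidableEq E]
    (ε : ℝ) (ρ : Matrix (X × E) (X × E) ℂ) : EReal :=
  ⨆ (ρ' : Matrix (X × E) (X × E) ℂ) (_ : IsSubState ρ') (_ : purifiedDist ρ' ρ ≤ ε),
    minEntropy ρ'

/-- The projector `|x⟩⟨x|`. -/
def proj {X : Type*} [DecidableEq X] (x : X) : Matrix X X ℂ := Matrix.single x x 1

/-- The maximally mixed state. -/
def maxMixed (X : Type*) [Fintype X] [DecidableEq X] : Matrix X X ℂ :=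
  ((Fintype.card X : ℂ)⁻¹) • 1

/-- The classical-quantum operator `∑ₓ |x⟩⟨x| ⊗ ρₓ`. -/
def cqState {X E : Type*} [Fintype X] [DecidableEq X] (ρ : X → Matrix E E ℂ) :
    Matrix (X × E) (X × E) ℂ :=
  ∑ x, Matrix.kronecker (proj x) (ρ x)

/-- The state after applying `Ext` to the source `∑ₓ |x⟩⟨x| ⊗ ρₓ` with an independent uniform
seed that is kept: `(1/|Y|) ∑_y ∑ₓ |Ext(x,y)⟩⟨Ext(x,y)| ⊗ |y⟩⟨y| ⊗ ρₓ`. -/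
def extractorOutput {X Y Z E : Type*} [Fintype X] [Fintype Y] [DecidableEq Y] [DecidableEq Z]
    (Ext : X → Y → Z) (ρ : X → Matrix E E ℂ) : Matrix (Z × Y × E) (Z × Y × E) ℂ :=
  ((Fintype.card Y : ℂ)⁻¹) •
    ∑ y, ∑ x, Matrix.kronecker (proj (Ext x y)) (Matrix.kronecker (proj y) (ρ x))

/-- `Ext : X × Y → Z` is a quantum-proof `(k, εExt)`-strong extractor: for every classical-quantum
source `ρ_XE = ∑ₓ |x⟩⟨x| ⊗ ρₓ` with finite-dimensional side information and every smoothing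
parameter `ε ≥ 0` with `H_min^ε(X|E) ≥ k`, the output satisfies
`½ ‖ρ_ZYE - μ_Z ⊗ μ_Y ⊗ ρ_E‖₁ ≤ εExt + 2 ε`. -/
def IsQuantumProofStrongExtractor {X Y Z : Type*} [Fintype X] [DecidableEq X]
    [Fintype Y] [DecidableEq Y] [Fintype Z] [DecidableEq Z]
    (k εExt : ℝ) (Ext : X → Y → Z) : Prop :=
  ∀ (E : Type) [Fintype E] [DecidableEq E] (ρ : X → Matrix E E ℂ),
    (∀ x, (ρ x).PosSemidef) → IsSubState (cqState ρ) →
    ∀ ε : ℝ, 0 ≤ ε → (k : EReal) ≤ smoothMinEntropy ε (cqState ρ) →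
      (1 / 2) * traceNorm (extractorOutput Ext ρ -
        Matrix.kronecker (maxMixed Z) (Matrix.kronecker (maxMixed Y) (∑ x, ρ x)))
        ≤ εExt + 2 * ε

/-- The family `(h y)_{y : Y}` of functions `X → Z` is `δ`-almost two-universal: `δ ≥ 1`, and for
uniformly random `y` any two distinct inputs collide with probability at most `δ / |Z|`. -/
def IsAlmostTwoUniversal {X Y Z : Type*} [Fintype Y] [Fintype Z] [DecidableEq Z]
    (δ : ℝ) (h : Y → X → Z) : Prop :=
  1 ≤ δ ∧ ∀ x x' : X, x ≠ x' →
    ((Finset.univ.filter fun y => h y x = h y x').card : ℝ) / (Fintype.card Y : ℝ)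
      ≤ δ / (Fintype.card Z : ℝ)

end

end QExt

namespace QExt

open scoped MatrixOrder Kronecker ComplexOrder

/-! ### Hilbert-Schmidt trace form. -/

section TraceForm

variable {m n : Type*} [Fintype m] [Fintype n]

/-! The trace norm of the defect (real minus ideal output) equals `Tr (T * defect)` for some
Hermitian `T` with `-1 ≤ T ≤ 1`, so it suffices to bound such tests.

Hashing: weighted Cauchy-Schwarz bounds the squared test by `Tr ξ` times a second moment of the
source, up to dimension factors. Its coefficients are collision probabilities minus `1/|Z|`,
controlled by almost two-universality. The reference is `ξ = τ_E + s σ`, with `σ` the min-entropy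
witness, `τ_x ≤ t σ` and `t = 2 ^ (-lam)`. It dominates `τ_E`, which controls the `δ - 1` term over
all pairs, and `(t / s) ξ` dominates each `τ_x`, which controls the diagonal. The squared test is
thus at most `(1 + s) (δ - 1 + |Z| t / s)`.

Smoothing: `IsContraction.exists_pullback` turns `T` into twice a contraction on the source, which
reads only the diagonal blocks in `X`. The smoothing state therefore need not be classical on `X`,
and Fuchs-van de Graaf (`IsContraction.re_trace_mul_sub_le_purifiedDist`) bounds the cost of
replacing it by the source. Finally `s = ε' ^ 2 / 2` matches the prescribed output length. -/

lemma re_trace_nonneg {A : Matrix n n ℂ} (hA : A.PosSemidef) : 0 ≤ A.trace.re :=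
  (Complex.le_def.1 hA.trace_nonneg).1

lemma re_trace_mul_nonneg {A B : Matrix n n ℂ} (hA : A.PosSemidef)
    (hB : B.PosSemidef) : 0 ≤ (A * B).trace.re := by
  classical
  have h0 : 0 ≤ B := Matrix.nonneg_iff_posSemidef.2 hB
  have hS := Matrix.nonneg_iff_posSemidef.1 (CFC.sqrt_nonneg B)
  rw [← CFC.sqrt_mul_sqrt_self B h0, ← mul_assoc, Matrix.trace_mul_comm, ← mul_assoc]
  have := hA.conjTranspose_mul_mul_same (CFC.sqrt B)
  rw [hS.1.eq] at this
  exact re_trace_nonneg this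

lemma re_trace_conjTranspose_mul_self_nonneg (A : Matrix m n ℂ) :
    0 ≤ (A.conjTranspose * A).trace.re :=
  re_trace_nonneg (Matrix.posSemidef_conjTranspose_mul_self A)

lemma re_trace_conjTranspose_mul_comm (A B : Matrix m n ℂ) :
    (A.conjTranspose * B).trace.re = (B.conjTranspose * A).trace.re := by
  have h : (B.conjTranspose * A).conjTranspose = A.conjTranspose * B := by simp
  rw [← h, Matrix.trace_conjTranspose]
  simp

/-- The Cauchy-Schwarz inequality for the Hilbert-Schmidt inner product. -/
lemma re_trace_conjTranspose_mul_sq_le (A B : Matrix m n ℂ) :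
    (A.conjTranspose * B).trace.re ^ 2 ≤
      (A.conjTranspose * A).trace.re * (B.conjTranspose * B).trace.re := by
  have key : ∀ c : ℝ, 0 ≤ (B.conjTranspose * B).trace.re * (c * c)
      + (2 * (A.conjTranspose * B).trace.re) * c + (A.conjTranspose * A).trace.re := by
    intro c
    have h := re_trace_conjTranspose_mul_self_nonneg (A + (c : ℂ) • B)
    have h2 := re_trace_conjTranspose_mul_comm A B
    simp only [Matrix.conjTranspose_add, Matrix.conjTranspose_smul, Matrix.add_mul, Matrix.mul_add,
      Matrix.trace_add, Complex.add_re, Matrix.smul_mul, Matrix.mul_smul, Matrix.trace_smul,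
      smul_eq_mul, Complex.star_def, Complex.conj_ofReal, Complex.re_ofReal_mul] at h
    rw [← h2] at h
    linarith
  have := discrim_le_zero key
  rw [discrim] at this
  nlinarith

end TraceForm

/-! ### Contractions, trace norm and polar decomposition. -/

section TraceNorm

variable {n : Type*} [Fintype n] [DecidableEq n]

/-- The spectrum is finite, so the functional calculus accepts discontinuous functions such as sign
and inverse. -/
lemma continuousOn_spectrum (f : ℝ → ℝ) (A : Matrix n n ℂ) : ContinuousOn f (spectrum ℝ A) :=
  (Matrix.finite_real_spectrum (A := A)).continuousOn f

/-- Operators with `-1 ≤ T ≤ 1`. -/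
def IsContraction (T : Matrix n n ℂ) : Prop :=
  (1 - T).PosSemidef ∧ (1 + T).PosSemidef

omit [Fintype n] in
lemma IsContraction.isHermitian {T : Matrix n n ℂ} (hT : IsContraction T) : T.IsHermitian := by
  have := hT.2.1.sub Matrix.isHermitian_one
  simpa using this

omit [Fintype n] in
lemma IsContraction.neg {T : Matrix n n ℂ} (hT : IsContraction T) : IsContraction (-T) :=
  ⟨by simpa using hT.2, by simpa [sub_eq_add_neg] using hT.1⟩

lemma isContraction_of_mul_self {T : Matrix n n ℂ} (hT : T.IsHermitian) (h : T * T = 1) :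
    IsContraction T := by
  have aux : ∀ S : Matrix n n ℂ, S.IsHermitian → S * S = 1 → (1 + S).PosSemidef := by
    intro S hS h
    have h1 := Matrix.posSemidef_conjTranspose_mul_self (1 + S)
    have h2 : (1 + S).conjTranspose * (1 + S) = (2 : ℝ) • (1 + S) := by
      rw [Matrix.conjTranspose_add, Matrix.conjTranspose_one, hS.eq, two_smul]
      noncomm_ring
      rw [h]; abel
    rw [h2] at h1
    have h3 := h1.smul (show (0 : ℝ) ≤ 1 / 2 by norm_num)
    rwa [smul_smul, show (1 / 2 : ℝ) * 2 = 1 by norm_num, one_smul] at h3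
  refine ⟨?_, aux T hT h⟩
  rw [sub_eq_add_neg]
  exact aux _ hT.neg (by simpa using h)

/-- `2 (1 - T²)` is the sum of `1 - T` conjugated by `1 + T` and `1 + T` conjugated by `1 - T`. -/
lemma IsContraction.one_sub_mul_self {T : Matrix n n ℂ} (hT : IsContraction T) :
    (1 - T * T).PosSemidef := by
  have hH := hT.isHermitian
  have h1 := hT.1.conjTranspose_mul_mul_same (1 + T)
  have h2 := hT.2.conjTranspose_mul_mul_same (1 - T)
  have h3 := (h1.add h2).smul (show (0 : ℝ) ≤ 1 / 2 by norm_num)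
  rw [hT.1.1.eq, hT.2.1.eq] at h3
  have : (1 - T * T) = (1 / 2 : ℝ) •
      ((1 + T) * (1 - T) * (1 + T) + (1 - T) * (1 + T) * (1 - T)) := by
    have : (1 + T) * (1 - T) * (1 + T) + (1 - T) * (1 + T) * (1 - T)
      = (2 : ℝ) • (1 - T * T) := by
      rw [two_smul]; noncomm_ring
    rw [this, smul_smul]; norm_num
  rwa [this]

lemma IsContraction.re_trace_mul_le {T : Matrix n n ℂ} (hT : IsContraction T)
    {A : Matrix n n ℂ} (hA : A.PosSemidef) : (T * A).trace.re ≤ A.trace.re := by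
  have := re_trace_mul_nonneg hT.1 hA
  rw [Matrix.sub_mul, Matrix.trace_sub, Complex.sub_re, one_mul] at this
  linarith

lemma IsContraction.re_trace_sq_le {m : Type*} [Fintype m] {T : Matrix n n ℂ}
    (hT : IsContraction T) (A B : Matrix n m ℂ) :
    (A.conjTranspose * (T * B)).trace.re ^ 2 ≤
      (A.conjTranspose * A).trace.re * (B.conjTranspose * B).trace.re := by
  refine (re_trace_conjTranspose_mul_sq_le A (T * B)).trans
    (mul_le_mul_of_nonneg_left ?_ (re_trace_conjTranspose_mul_self_nonneg A))
  have h := re_trace_nonneg (hT.one_sub_mul_self.conjTranspose_mul_mul_same B)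
  rw [Matrix.mul_sub, Matrix.sub_mul, Matrix.trace_sub, Complex.sub_re, Matrix.mul_one] at h
  rw [Matrix.conjTranspose_mul, hT.isHermitian.eq]
  simp only [Matrix.mul_assoc] at h ⊢
  linarith

/-- The trace norm of a Hermitian operator is attained at its sign. -/
lemma exists_traceNorm_eq {A : Matrix n n ℂ} (hA : A.IsHermitian) :
    ∃ T : Matrix n n ℂ, T.IsHermitian ∧ T * T = 1 ∧ traceNorm A = (T * A).trace.re := by
  have hA' : IsSelfAdjoint A := hA
  -- The sign takes the value `1` at `0`, so that `T * T = 1` even when `A` is singular.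
  refine ⟨cfc (fun x : ℝ => if 0 ≤ x then 1 else -1) A, cfc_predicate (R := ℝ) _ A, ?_, ?_⟩
  · rw [← cfc_mul _ _ A (continuousOn_spectrum _ _) (continuousOn_spectrum _ _),
      ← cfc_one ℝ A]
    refine cfc_congr fun x _ => ?_
    by_cases h : 0 ≤ x <;> simp [h]
  · have h1 : CFC.sqrt (A.conjTranspose * A) = cfc (fun x : ℝ => |x|) A := by
      apply CFC.sqrt_unique
      · rw [← cfc_mul _ _ A (continuousOn_spectrum _ _) (continuousOn_spectrum _ _), hA.eq]
        conv_rhs => rw [← cfc_id' ℝ A, ← cfc_mul _ _ A (continuousOn_spectrum _ _)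
          (continuousOn_spectrum _ _)]
        exact cfc_congr fun x _ => abs_mul_abs_self x
      · exact cfc_nonneg fun x _ => abs_nonneg x
    rw [traceNorm, h1]
    congr 2
    conv_rhs => rw [← cfc_id' ℝ A]
    rw [cfc_id' ℝ A]
    conv_rhs => arg 2; rw [← cfc_id' ℝ A]
    rw [← cfc_mul _ _ A (continuousOn_spectrum _ _) (continuousOn_spectrum _ _)]
    refine cfc_congr fun x _ => ?_
    by_cases h : 0 ≤ x
    · simp [h, abs_of_nonneg h]
    · simp [h, abs_of_neg (not_le.1 h)]

/-- A partial isometry `W` with `tr (A W) = ‖A‖₁`. -/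
lemma exists_partialIsometry_traceNorm_eq (A : Matrix n n ℂ) :
    ∃ W P : Matrix n n ℂ, P.IsHermitian ∧ P * P = P ∧ W * W.conjTranspose = P ∧
      (A * W).trace.re = traceNorm A := by
  set H := CFC.sqrt (A.conjTranspose * A) with hH
  have hpos : 0 ≤ A.conjTranspose * A :=
    Matrix.nonneg_iff_posSemidef.2 (Matrix.posSemidef_conjTranspose_mul_self A)
  have hHH : H * H = A.conjTranspose * A := CFC.sqrt_mul_sqrt_self _ hpos
  have hHs : IsSelfAdjoint H := (Matrix.nonneg_iff_posSemidef.1 (CFC.sqrt_nonneg _)).1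
  -- Since `0⁻¹ = 0`, `G` is the pseudo-inverse of `|A|` and `G * H` its support projection.
  set G := cfc (fun x : ℝ => x⁻¹) H with hG
  have hGs : G.conjTranspose = G := (cfc_predicate (R := ℝ) _ H : IsSelfAdjoint G)
  have hr : ∀ f : ℝ → ℝ, cfc f H * H = cfc (fun x => f x * x) H := fun f => by
    conv_lhs => arg 2; rw [← cfc_id' ℝ H]
    rw [← cfc_mul _ _ H (continuousOn_spectrum _ _) (continuousOn_spectrum _ _)]
  have hl : ∀ f : ℝ → ℝ, H * cfc f H = cfc (fun x => x * f x) H := fun f => by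
    conv_lhs => arg 1; rw [← cfc_id' ℝ H]
    rw [← cfc_mul _ _ H (continuousOn_spectrum _ _) (continuousOn_spectrum _ _)]
  have hGHH : G * (H * H) = H := by
    rw [hG, ← mul_assoc, hr, hr]
    conv_rhs => rw [← cfc_id' ℝ H]
    refine cfc_congr fun x _ => ?_
    by_cases h : x = 0 <;> simp [h]
  have hP : G * H * (G * H) = G * H := by
    rw [hG, hr, ← cfc_mul _ _ H (continuousOn_spectrum _ _) (continuousOn_spectrum _ _)]
    refine cfc_congr fun x _ => ?_
    by_cases h : x = 0 <;> simp [h]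
  have hcomm : H * G = G * H := by
    rw [hG, hr, hl]
    exact cfc_congr fun x _ => mul_comm _ _
  have hHc : H.conjTranspose = H := hHs
  refine ⟨G * A.conjTranspose, G * H, ?_, hP, ?_, ?_⟩
  · rw [Matrix.IsHermitian, Matrix.conjTranspose_mul, hGs, hHc, hcomm]
  · rw [Matrix.conjTranspose_mul, hGs, Matrix.conjTranspose_conjTranspose, mul_assoc,
      ← mul_assoc A.conjTranspose, ← hHH, ← mul_assoc, hGHH, hcomm]
  · rw [Matrix.trace_mul_comm, mul_assoc, ← hHH, hGHH, traceNorm]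

end TraceNorm

/-! ### Fuchs-van de Graaf inequality. -/

/-- Multiplying the hypotheses gives `4 (1 - f²)`. Dropping the squares `(a ∓ b)²` leaves `(p + r)
(q + r)`, at least `(√p √q + r)²` by Cauchy-Schwarz. -/
lemma half_sqrt_mul_sqrt_add_le {p q r a b f : ℝ} (hp : 0 ≤ p) (hq : 0 ≤ q) (hr : 0 ≤ r)
    (h1 : p + r + (a - b) ^ 2 = 2 * (1 - f)) (h2 : q + r + (a + b) ^ 2 = 2 * (1 + f)) :
    (√p * √q + r) / 2 ≤ √(1 - f ^ 2) := by
  have h4 : 1 - f ^ 2 = (p + r + (a - b) ^ 2) * (q + r + (a + b) ^ 2) / 4 := by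
    rw [h1, h2]; ring
  apply Real.le_sqrt_of_sq_le
  rw [h4]
  have h7 : 0 ≤ r * (√p - √q) ^ 2 := mul_nonneg hr (sq_nonneg _)
  have h8 : 0 ≤ (p + r) * (a + b) ^ 2 := by positivity
  have h9 : 0 ≤ (a - b) ^ 2 * (q + r + (a + b) ^ 2) := by positivity
  have h10 : (√p * √q + r) ^ 2 = p * q + 2 * r * (√p * √q) + r ^ 2 := by
    rw [add_sq, mul_pow, Real.sq_sqrt hp, Real.sq_sqrt hq]; ring
  have h11 : r * (√p - √q) ^ 2 = r * (p + q) - 2 * r * (√p * √q) := by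
    rw [sub_sq, Real.sq_sqrt hp, Real.sq_sqrt hq]; ring
  rw [div_pow, h10]
  linarith

/-- The Fuchs-van de Graaf inequality for sub-normalized states, in variational form. -/
lemma IsContraction.re_trace_mul_sub_le_purifiedDist {n : Type*} [Fintype n] [DecidableEq n]
    {T ρ σ : Matrix n n ℂ} (hT : IsContraction T) (hρ : IsSubState ρ) (hσ : IsSubState σ) :
    (T * (ρ - σ)).trace.re ≤ 2 * purifiedDist ρ σ := by
  obtain ⟨hρ0, hρ1⟩ := hρ
  obtain ⟨hσ0, hσ1⟩ := hσ
  obtain ⟨W, P, hPh, hPP, hWP, hF⟩ :=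
    exists_partialIsometry_traceNorm_eq (CFC.sqrt ρ * CFC.sqrt σ)
  have hM : CFC.sqrt ρ * CFC.sqrt ρ = ρ :=
    CFC.sqrt_mul_sqrt_self _ (Matrix.nonneg_iff_posSemidef.2 hρ0)
  have hS : CFC.sqrt σ * CFC.sqrt σ = σ :=
    CFC.sqrt_mul_sqrt_self _ (Matrix.nonneg_iff_posSemidef.2 hσ0)
  have hMh : (CFC.sqrt ρ).conjTranspose = CFC.sqrt ρ :=
    (Matrix.nonneg_iff_posSemidef.1 (CFC.sqrt_nonneg ρ)).1
  have hSh : (CFC.sqrt σ).conjTranspose = CFC.sqrt σ :=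
    (Matrix.nonneg_iff_posSemidef.1 (CFC.sqrt_nonneg σ)).1
  rw [purifiedDist]
  set M := CFC.sqrt ρ
  set S := CFC.sqrt σ
  set F := traceNorm (M * S)
  rw [Real.sqrt_mul (by linarith)]
  set a := √(1 - ρ.trace.re) with ha
  set b := √(1 - σ.trace.re) with hb
  have ha2 : a ^ 2 = 1 - ρ.trace.re := Real.sq_sqrt (by linarith)
  have hb2 : b ^ 2 = 1 - σ.trace.re := Real.sq_sqrt (by linarith)
  -- `N` has overlap `F` with `M`. As `W` is only a partial isometry, `N * N†` can miss part of `σ`;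
  -- `R` supplies it.
  set N := S * W with hN
  set R := S * (1 - P) with hR
  have hNN : N * N.conjTranspose + R * R.conjTranspose = σ := by
    have h1 : N * N.conjTranspose = S * P * S := by
      rw [hN, Matrix.conjTranspose_mul, hSh, ← hWP]; simp only [mul_assoc]
    have h2 : R * R.conjTranspose = S * (1 - P) * S := by
      rw [hR, Matrix.conjTranspose_mul, hSh, Matrix.conjTranspose_sub, Matrix.conjTranspose_one,
        hPh.eq]
      have : (1 - P) * (1 - P) = 1 - P := by noncomm_ring; rw [hPP]; abel
      rw [mul_assoc, ← mul_assoc (1 - P), this, mul_assoc]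
    rw [h1, h2, ← hS]; noncomm_ring
  have hMM : M * M.conjTranspose = ρ := by rw [hMh, hM]
  have hMN : (M.conjTranspose * N).trace.re = F := by rw [hMh, hN, ← mul_assoc]; exact hF
  have hNM : (N.conjTranspose * M).trace.re = F := by rw [re_trace_conjTranspose_mul_comm, hMN]
  have hnormM : (M.conjTranspose * M).trace.re = ρ.trace.re := by rw [hMh, hM]
  have hnormN : (N.conjTranspose * N).trace.re + (R.conjTranspose * R).trace.re = σ.trace.re := by
    rw [Matrix.trace_mul_comm, Matrix.trace_mul_comm R.conjTranspose, ← Complex.add_re,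
      ← Matrix.trace_add, hNN]
  have c1 := hT.re_trace_sq_le (M - N) (M + N)
  have c2 := hT.re_trace_sq_le R R
  -- Polarization: the cross terms of `(M + N) (M - N)†` cancel under `Re Tr (T ·)` because `T` is
  -- Hermitian.
  have e1 : (T * (ρ - σ)).trace.re = ((M - N).conjTranspose * (T * (M + N))).trace.re
      - (R.conjTranspose * (T * R)).trace.re := by
    have t1 : ∀ U V : Matrix n n ℂ, (U.conjTranspose * (T * V)).trace.re
        = (T * (V * U.conjTranspose)).trace.re := fun U V => by
      rw [Matrix.trace_mul_comm, mul_assoc]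
    have t2 : (T * (M * N.conjTranspose)).trace.re = (T * (N * M.conjTranspose)).trace.re := by
      rw [← t1, ← t1]
      have := re_trace_conjTranspose_mul_comm N (T * M)
      rw [this, Matrix.conjTranspose_mul, hT.isHermitian.eq, mul_assoc]
    rw [t1, t1, ← hNN, ← hMM]
    simp only [Matrix.conjTranspose_sub, Matrix.mul_sub, Matrix.mul_add, Matrix.add_mul,
      Matrix.trace_sub, Matrix.trace_add, Complex.sub_re, Complex.add_re] at t2 ⊢
    linarith
  have n1 : ((M - N).conjTranspose * (M - N)).trace.re
      = ρ.trace.re + (N.conjTranspose * N).trace.re - 2 * F := by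
    simp only [Matrix.conjTranspose_sub, Matrix.sub_mul, Matrix.mul_sub, Matrix.trace_sub,
      Complex.sub_re]
    linarith
  have n2 : ((M + N).conjTranspose * (M + N)).trace.re
      = ρ.trace.re + (N.conjTranspose * N).trace.re + 2 * F := by
    simp only [Matrix.conjTranspose_add, Matrix.add_mul, Matrix.mul_add, Matrix.trace_add,
      Complex.add_re]
    linarith
  have p1 := re_trace_conjTranspose_mul_self_nonneg (M - N)
  have p2 := re_trace_conjTranspose_mul_self_nonneg (M + N)
  have p3 := re_trace_conjTranspose_mul_self_nonneg R
  rw [e1]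
  set u := ((M - N).conjTranspose * (T * (M + N))).trace.re
  set v := (R.conjTranspose * (T * R)).trace.re
  set p := ((M - N).conjTranspose * (M - N)).trace.re
  set q := ((M + N).conjTranspose * (M + N)).trace.re
  set r := (R.conjTranspose * R).trace.re
  have hv : |v| ≤ r := abs_le_of_sq_le_sq (by linarith [sq r]) p3
  have hu : |u| ≤ √p * √q := by
    rw [← Real.sqrt_mul p1]; exact Real.abs_le_sqrt c1
  -- The trace deficits `a²` and `b²` act as an extra coordinate completing both traces to one.
  have h6 := half_sqrt_mul_sqrt_add_le p1 p2 p3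
    (show p + r + (a - b) ^ 2 = 2 * (1 - (F + a * b)) by linarith [sub_sq a b])
    (show q + r + (a + b) ^ 2 = 2 * (1 + (F + a * b)) by linarith [add_sq a b])
  linarith [le_abs_self u, neg_abs_le v]

/-! ### Weighted Cauchy-Schwarz inequality. -/

section Weighted

variable {n : Type*} [Fintype n] [DecidableEq n]

/-- The Cauchy-Schwarz inequality with a weight `Q ^ 4` and its inverse square root `K ^ 2`. -/
lemma IsContraction.re_trace_mul_sq_le_weighted {T A Q K : Matrix n n ℂ} (hT : IsContraction T)
    (hA : A.IsHermitian) (hQ : Q.IsHermitian) (hK : K.IsHermitian) (hQK : Q * K = 1) :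
    (T * A).trace.re ^ 2 ≤
      (Q * Q * (Q * Q)).trace.re * ((K * K) * A * ((K * K) * A)).trace.re := by
  have hKQ : K * Q = 1 := mul_eq_one_comm.1 hQK
  have hTh := hT.isHermitian
  -- The weight is split evenly on both sides, pairing `Q T Q` with `K A K`; this is why a fourth
  -- root is needed.
  have h1 : (T * A).trace = ((Q * T * Q).conjTranspose * (K * A * K)).trace := by
    rw [Matrix.conjTranspose_mul, Matrix.conjTranspose_mul, hQ.eq, hTh.eq]
    calc (T * A).trace = (T * (Q * K) * A * (K * Q)).trace := by rw [hQK, hKQ]; simp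
      _ = ((T * (Q * K) * A * K) * Q).trace := by simp only [mul_assoc]
      _ = _ := by rw [Matrix.trace_mul_comm]; simp only [mul_assoc]
  have h2 : ((K * A * K).conjTranspose * (K * A * K)).trace
      = ((K * K) * A * ((K * K) * A)).trace := by
    rw [Matrix.conjTranspose_mul, Matrix.conjTranspose_mul, hK.eq, hA.eq]
    calc _ = (K * (A * (K * K) * A * K)).trace := by simp only [mul_assoc]
      _ = (K * (K * A * (K * K) * A)).trace := by
        rw [show K * (A * (K * K) * A * K) = (K * (A * (K * K) * A)) * K by
          simp only [mul_assoc], Matrix.trace_mul_comm]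
        simp only [mul_assoc]
      _ = _ := by simp only [mul_assoc]
  have h3 : ((Q * T * Q).conjTranspose * (Q * T * Q)).trace
      = ((Q * Q * T).conjTranspose * (T * (Q * Q))).trace := by
    simp only [Matrix.conjTranspose_mul, hQ.eq, hTh.eq]
    rw [Matrix.trace_mul_comm]
    calc _ = (Q * (T * Q * (Q * (T * Q)))).trace := by simp only [mul_assoc]
      _ = _ := by rw [Matrix.trace_mul_comm]; simp only [mul_assoc]
  have h4 : ((Q * Q * T).conjTranspose * (Q * Q * T)).trace.re ≤ (Q * Q * (Q * Q)).trace.re := by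
    have hp : (Q * Q * (Q * Q)).PosSemidef := by
      have := Matrix.posSemidef_conjTranspose_mul_self (Q * Q)
      rwa [Matrix.conjTranspose_mul, hQ.eq] at this
    have := re_trace_mul_nonneg hT.one_sub_mul_self hp
    rw [Matrix.sub_mul, Matrix.trace_sub, Complex.sub_re, one_mul] at this
    have e : ((Q * Q * T).conjTranspose * (Q * Q * T)).trace
        = (T * T * (Q * Q * (Q * Q))).trace := by
      simp only [Matrix.conjTranspose_mul, hQ.eq, hTh.eq]
      calc _ = (T * (Q * Q * (Q * Q)) * T).trace := by simp only [mul_assoc]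
        _ = _ := by rw [Matrix.trace_mul_comm]; simp only [mul_assoc]
    rw [e]; linarith
  have h5 : ((Q * Q).conjTranspose * (Q * Q)).trace.re = (Q * Q * (Q * Q)).trace.re := by
    rw [Matrix.conjTranspose_mul, hQ.eq]
  have h6 := re_trace_conjTranspose_mul_self_nonneg (Q * Q)
  have h7 := re_trace_conjTranspose_mul_self_nonneg (Q * Q * T)
  have h8 := hT.re_trace_sq_le (Q * Q * T) (Q * Q)
  rw [h5] at h6 h8
  -- A second Cauchy-Schwarz, between `Q² T` and `T Q²`, with `T² ≤ 1` removing `T` from the norms.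
  have h9 : ((Q * T * Q).conjTranspose * (Q * T * Q)).trace.re ≤ (Q * Q * (Q * Q)).trace.re := by
    rw [h3]
    exact abs_le_of_sq_le_sq' (h8.trans (by nlinarith)) h6 |>.2
  rw [h1, ← h2]
  exact (re_trace_conjTranspose_mul_sq_le _ _).trans
    (mul_le_mul_of_nonneg_right h9 (re_trace_conjTranspose_mul_self_nonneg _))

/-- Fourth root of a positive definite matrix together with the inverse. -/
lemma exists_fourth_root {ξ : Matrix n n ℂ} (hξ : ξ.PosDef) :
    ∃ Q K : Matrix n n ℂ, Q.IsHermitian ∧ K.IsHermitian ∧ Q * K = 1 ∧ Q * Q * (Q * Q) = ξ := by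
  have h0 : 0 ≤ ξ := Matrix.nonneg_iff_posSemidef.2 hξ.posSemidef
  set Q := CFC.sqrt (CFC.sqrt ξ)
  have h2 : Q * Q = CFC.sqrt ξ := CFC.sqrt_mul_sqrt_self _ (CFC.sqrt_nonneg _)
  have h4 : Q * Q * (Q * Q) = ξ := by rw [h2, CFC.sqrt_mul_sqrt_self _ h0]
  have hQ : Q.IsHermitian := (Matrix.nonneg_iff_posSemidef.1 (CFC.sqrt_nonneg _)).1
  have hdet : IsUnit Q.det := by
    have := (Matrix.isUnit_iff_isUnit_det _).1 hξ.isUnit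
    rw [← h4, Matrix.det_mul, Matrix.det_mul] at this
    exact isUnit_of_mul_isUnit_left (isUnit_of_mul_isUnit_left this)
  exact ⟨Q, Q⁻¹, hQ, hQ.inv, Matrix.mul_nonsing_inv _ hdet, h4⟩

end Weighted

/-! ### Block form and second moment of the defect. -/

section Hash

lemma trace_proj_mul_proj {I : Type*} [Fintype I] [DecidableEq I] (i j : I) :
    (proj i * proj j : Matrix I I ℂ).trace = if i = j then 1 else 0 := by
  by_cases hij : i = j
  · subst hij; simp [proj]
  · simp [proj, hij]

variable {X Y Z E : Type*} [Fintype X] [DecidableEq X] [Fintype Y] [DecidableEq Y]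
  [Fintype Z] [DecidableEq Z] [Fintype E] [DecidableEq E]

/-- The difference between the extractor output and the ideal output. -/
noncomputable def extractorDefect (h : Y → X → Z) (τ : X → Matrix E E ℂ) :
    Matrix (Z × Y × E) (Z × Y × E) ℂ :=
  extractorOutput (fun x y => h y x) τ -
    Matrix.kronecker (maxMixed Z) (Matrix.kronecker (maxMixed Y) (∑ x, τ x))

/-- Coefficients of the diagonal blocks of the extractor defect. -/
noncomputable def defectCoeff (h : Y → X → Z) (z : Z) (y : Y) (x : X) : ℝ :=
  (Fintype.card Y : ℝ)⁻¹ * ((if h y x = z then 1 else 0) - (Fintype.card Z : ℝ)⁻¹)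

omit [DecidableEq X] [Fintype E] [DecidableEq E] in
lemma extractorDefect_eq_sum (h : Y → X → Z) (τ : X → Matrix E E ℂ) :
    extractorDefect h τ = ∑ z, ∑ y, Matrix.kronecker (proj z)
      (Matrix.kronecker (proj y) (∑ x, (defectCoeff h z y x : ℂ) • τ x)) := by
  ext ⟨z, y, e⟩ ⟨z', y', e'⟩
  simp only [extractorDefect, extractorOutput, maxMixed, proj, Matrix.sub_apply, Matrix.smul_apply,
    Matrix.sum_apply, Matrix.kronecker, Matrix.kroneckerMap_apply, Matrix.single_apply,
    Matrix.one_apply, defectCoeff, smul_eq_mul, ite_and, ite_mul, one_mul, zero_mul,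
    Finset.sum_ite_irrel, Finset.sum_const_zero, Finset.sum_ite_eq', Finset.mem_univ, if_true]
  have inner : (∑ y₁, ∑ x, if h y₁ x = z then if h y₁ x = z' then if y₁ = y then
      if y₁ = y' then τ x e e' else 0 else 0 else 0 else 0) =
      if z = z' then if y = y' then ∑ x, if h y x = z then τ x e e' else 0 else 0 else 0 := by
    rw [Finset.sum_eq_single y]
    · by_cases hz : z = z'
      · subst hz
        by_cases hy : y = y' <;> simp +contextual [hy]
      · rw [if_neg hz]
        refine Finset.sum_eq_zero fun x _ => ?_
        by_cases hx : h y x = z <;> simp [hx, hz]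
    · intro b _ hb
      simp [hb]
    · simp
  by_cases hz : z = z'
  · subst hz
    by_cases hy : y = y'
    · subst hy
      simp only [if_true] at inner ⊢
      rw [inner, Finset.mul_sum, Finset.mul_sum, Finset.mul_sum, ← Finset.sum_sub_distrib]
      refine Finset.sum_congr rfl fun x _ => ?_
      by_cases hx : h y x = z
      · simp [hx]; ring
      · simp [hx]; ring
    · simp only [hy, if_true, if_false] at inner ⊢
      simp [inner]
  · simp only [hz, if_false] at inner ⊢
    simp [inner]

omit [Fintype X] [DecidableEq X] [DecidableEq Y] in
-- Summed over `z`, the product of indicators detects a collision, the two cross terms give `-2/|Z|`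
-- and the constant gives `+1/|Z|`.
lemma sum_defectCoeff_mul [Nonempty Y] [Nonempty Z] (h : Y → X → Z) (x x' : X) :
    ∑ z, ∑ y, defectCoeff h z y x * defectCoeff h z y x' = (Fintype.card Y : ℝ)⁻¹ *
      (((Finset.univ.filter fun y => h y x = h y x').card : ℝ) / (Fintype.card Y : ℝ)
        - (Fintype.card Z : ℝ)⁻¹) := by
  have hZ : (Fintype.card Z : ℝ) ≠ 0 := by simp
  have hY : (Fintype.card Y : ℝ) ≠ 0 := by simp
  have inner : ∀ y, ∑ z, defectCoeff h z y x * defectCoeff h z y x' =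
      (Fintype.card Y : ℝ)⁻¹ ^ 2 * ((if h y x = h y x' then 1 else 0) - (Fintype.card Z : ℝ)⁻¹) := by
    intro y
    have : ∀ z, defectCoeff h z y x * defectCoeff h z y x' = (Fintype.card Y : ℝ)⁻¹ ^ 2 *
        ((if h y x = z then (if h y x' = z then 1 else 0) else 0)
          - (Fintype.card Z : ℝ)⁻¹ * (if h y x = z then 1 else 0)
          - (Fintype.card Z : ℝ)⁻¹ * (if h y x' = z then 1 else 0)
          + (Fintype.card Z : ℝ)⁻¹ ^ 2) := by
      intro z
      rw [defectCoeff, defectCoeff]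
      split_ifs <;> ring
    simp only [this, ← Finset.mul_sum, Finset.sum_add_distrib, Finset.sum_sub_distrib,
      Finset.sum_ite_eq, Finset.mem_univ, if_true, Finset.sum_const, Finset.card_univ,
      nsmul_eq_mul, eq_comm (a := h y x') (b := h y x)]
    field_simp
    ring
  rw [Finset.sum_comm]
  simp only [inner, ← Finset.mul_sum, Finset.sum_sub_distrib, Finset.sum_boole, Finset.sum_const,
    Finset.card_univ, nsmul_eq_mul]
  field_simp

omit [DecidableEq X] [DecidableEq E] in
/-- Second moment of a block diagonal operator with respect to a product weight. -/
lemma re_trace_sq_extractorDefect (h : Y → X → Z) (τ : X → Matrix E E ℂ) (κ : Matrix E E ℂ) :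
    (Matrix.kronecker (1 : Matrix Z Z ℂ) (Matrix.kronecker (1 : Matrix Y Y ℂ) κ)
        * extractorDefect h τ
      * (Matrix.kronecker (1 : Matrix Z Z ℂ) (Matrix.kronecker (1 : Matrix Y Y ℂ) κ)
        * extractorDefect h τ)).trace.re =
      ∑ x, ∑ x', (∑ z, ∑ y, defectCoeff h z y x * defectCoeff h z y x')
        * (κ * τ x * (κ * τ x')).trace.re := by
  have e1 : Matrix.kronecker (1 : Matrix Z Z ℂ) (Matrix.kronecker (1 : Matrix Y Y ℂ) κ)
      * extractorDefect h τ = ∑ z, ∑ y, Matrix.kronecker (proj z)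
        (Matrix.kronecker (proj y) (∑ x, (defectCoeff h z y x : ℂ) • (κ * τ x))) := by
    simp only [extractorDefect_eq_sum, Finset.mul_sum, Matrix.kronecker,
      ← Matrix.mul_kronecker_mul, one_mul, Matrix.mul_smul]
  have e2 : ∀ B : Z → Y → Matrix E E ℂ, ((∑ z, ∑ y, Matrix.kronecker (proj z)
      (Matrix.kronecker (proj y) (B z y))) * (∑ z, ∑ y, Matrix.kronecker (proj z)
      (Matrix.kronecker (proj y) (B z y)))).trace = ∑ z, ∑ y, (B z y * B z y).trace := by
    intro B
    simp only [Finset.mul_sum, Finset.sum_mul, Matrix.kronecker, ← Matrix.mul_kronecker_mul,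
      Matrix.trace_sum, Matrix.trace_kronecker, trace_proj_mul_proj, ite_mul, one_mul, zero_mul,
      Finset.sum_ite_eq', Finset.sum_ite_irrel, Finset.sum_const_zero,
      Finset.mem_univ, if_true]
  rw [e1, e2]
  simp only [Finset.mul_sum, Finset.sum_mul, Matrix.trace_sum, Matrix.smul_mul, Matrix.mul_smul,
    Matrix.trace_smul, Complex.re_sum, smul_eq_mul, Complex.re_ofReal_mul]
  have e3 : ∀ z : Z, ∑ y, ∑ x', ∑ x, defectCoeff h z y x' * (defectCoeff h z y x *
      (κ * τ x * (κ * τ x')).trace.re) = ∑ x, ∑ x', ∑ y, defectCoeff h z y x *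
        defectCoeff h z y x' * (κ * τ x * (κ * τ x')).trace.re := by
    intro z
    rw [Finset.sum_congr rfl fun y _ => Finset.sum_comm, Finset.sum_comm]
    refine Finset.sum_congr rfl fun x _ => ?_
    rw [Finset.sum_comm]
    refine Finset.sum_congr rfl fun x' _ => Finset.sum_congr rfl fun y _ => by ring
  rw [Finset.sum_congr rfl fun z _ => e3 z, Finset.sum_comm]
  exact Finset.sum_congr rfl fun x _ => Finset.sum_comm

end Hash

lemma isHermitian_proj {I : Type*} [DecidableEq I] (i : I) :
    (proj i : Matrix I I ℂ).IsHermitian := by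
  simp [proj, Matrix.IsHermitian]

lemma isHermitian_kronecker {m n : Type*} {A : Matrix m m ℂ} {B : Matrix n n ℂ}
    (hA : A.IsHermitian) (hB : B.IsHermitian) : (Matrix.kronecker A B).IsHermitian := by
  rw [Matrix.IsHermitian, Matrix.kronecker, Matrix.conjTranspose_kronecker, hA.eq, hB.eq]

/-- An operator below `c • ξ` has second moment at most `c` times its trace with respect to the
inverse square root `κ` of `ξ`. -/
lemma re_trace_weighted_le {E : Type*} [Fintype E] [DecidableEq E] {κ ξ M : Matrix E E ℂ} {c : ℝ}
    (hκ : κ.IsHermitian) (h : κ * ξ * κ = 1) (hM : M.PosSemidef) (hc : (c • ξ - M).PosSemidef) :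
    (κ * M * (κ * M)).trace.re ≤ c * M.trace.re := by
  have h1 := hM.conjTranspose_mul_mul_same κ
  rw [hκ.eq] at h1
  have h2 := re_trace_mul_nonneg h1 hc
  have h3 : (κ * M * κ * ξ).trace = M.trace := by
    calc (κ * M * κ * ξ).trace = (κ * (M * κ * ξ)).trace := by simp only [mul_assoc]
      _ = (M * (κ * ξ * κ)).trace := by rw [Matrix.trace_mul_comm]; simp only [mul_assoc]
      _ = _ := by rw [h, mul_one]
  rw [Matrix.mul_sub, Matrix.trace_sub, Complex.sub_re, Matrix.mul_smul, Matrix.trace_smul, h3,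
    Complex.smul_re, smul_eq_mul] at h2
  rw [← mul_assoc]
  linarith

/-! ### Leftover hashing against a reference operator. -/

section Hash

variable {X Y Z E : Type*} [Fintype X] [Fintype Y] [DecidableEq Y]
  [Fintype Z] [DecidableEq Z]

lemma isHermitian_extractorDefect (h : Y → X → Z) {τ : X → Matrix E E ℂ}
    (hτ : ∀ x, (τ x).IsHermitian) : (extractorDefect h τ).IsHermitian := by
  rw [extractorDefect_eq_sum, Matrix.IsHermitian, Matrix.conjTranspose_sum]
  refine Finset.sum_congr rfl fun z _ => ?_
  rw [Matrix.conjTranspose_sum]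
  refine Finset.sum_congr rfl fun y _ => ?_
  refine (isHermitian_kronecker (isHermitian_proj z) (isHermitian_kronecker (isHermitian_proj y)
    ?_)).eq
  rw [Matrix.IsHermitian, Matrix.conjTranspose_sum]
  refine Finset.sum_congr rfl fun x _ => ?_
  rw [Matrix.conjTranspose_smul, (hτ x).eq]
  simp

variable [DecidableEq X] [Fintype E] [DecidableEq E] [Nonempty Y] [Nonempty Z]

/-- Leftover hashing with respect to a positive definite reference operator `ξ`. -/
lemma IsContraction.re_trace_mul_extractorDefect_sq_le {T : Matrix (Z × Y × E) (Z × Y × E) ℂ}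
    (hT : IsContraction T) {h : Y → X → Z} {δ : ℝ} (hh : IsAlmostTwoUniversal δ h)
    {τ : X → Matrix E E ℂ} (hτ : ∀ x, (τ x).PosSemidef) {ξ : Matrix E E ℂ} (hξ : ξ.PosDef)
    {c : ℝ} (hc : ∀ x, (c • ξ - τ x).PosSemidef) (hE : (ξ - ∑ x, τ x).PosSemidef) :
    (T * extractorDefect h τ).trace.re ^ 2 ≤
      ξ.trace.re * ((δ - 1 + Fintype.card Z * c) * (∑ x, τ x).trace.re) := by
  obtain ⟨Q, K, hQ, hK, hQK, hQξ⟩ := exists_fourth_root hξ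
  have hZ : (0 : ℝ) < Fintype.card Z := by exact_mod_cast Fintype.card_pos
  have hY : (0 : ℝ) < Fintype.card Y := by exact_mod_cast Fintype.card_pos
  have base := hT.re_trace_mul_sq_le_weighted
    (isHermitian_extractorDefect h fun x => (hτ x).isHermitian)
    (isHermitian_kronecker Matrix.isHermitian_one (isHermitian_kronecker Matrix.isHermitian_one hQ))
    (isHermitian_kronecker Matrix.isHermitian_one (isHermitian_kronecker Matrix.isHermitian_one hK))
    (by simp only [Matrix.kronecker, ← Matrix.mul_kronecker_mul, one_mul, hQK,
      Matrix.one_kronecker_one])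
  have m1 : ∀ B C : Matrix E E ℂ, Matrix.kronecker (1 : Matrix Z Z ℂ)
      (Matrix.kronecker (1 : Matrix Y Y ℂ) B) * Matrix.kronecker (1 : Matrix Z Z ℂ)
      (Matrix.kronecker (1 : Matrix Y Y ℂ) C) = Matrix.kronecker (1 : Matrix Z Z ℂ)
      (Matrix.kronecker (1 : Matrix Y Y ℂ) (B * C)) := fun B C => by
    simp only [Matrix.kronecker, ← Matrix.mul_kronecker_mul, one_mul]
  have m2 : (Matrix.kronecker (1 : Matrix Z Z ℂ) (Matrix.kronecker (1 : Matrix Y Y ℂ) ξ)).trace.re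
      = Fintype.card Z * (Fintype.card Y * ξ.trace.re) := by
    simp only [Matrix.kronecker, Matrix.trace_kronecker, Matrix.trace_one]
    rw [← Complex.ofReal_natCast, ← Complex.ofReal_natCast, Complex.re_ofReal_mul,
      Complex.re_ofReal_mul]
  rw [m1, m1, m1, hQξ, m2, re_trace_sq_extractorDefect] at base
  set κ := K * K with hκ
  have hκh : κ.IsHermitian := by rw [Matrix.IsHermitian, hκ, Matrix.conjTranspose_mul, hK.eq]
  have hKQ : K * Q = 1 := mul_eq_one_comm.1 hQK
  have hκξ : κ * ξ * κ = 1 := by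
    rw [← hQξ, hκ]
    calc K * K * (Q * Q * (Q * Q)) * (K * K)
        = K * (K * Q) * Q * (Q * (Q * K) * K) := by simp only [mul_assoc]
      _ = 1 := by rw [hKQ, hQK]; simp [hKQ, hQK]
  have hg : ∀ x x', 0 ≤ (κ * τ x * (κ * τ x')).trace.re := fun x x' => by
    have := (hτ x).conjTranspose_mul_mul_same κ
    rw [hκh.eq] at this
    rw [← mul_assoc]
    exact re_trace_mul_nonneg this (hτ x')
  set S := ∑ x, τ x with hS
  have hSp : S.PosSemidef := Matrix.posSemidef_sum _ fun x _ => hτ x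
  -- The double sum is the second moment of `S`, so `S ≤ ξ` bounds it.
  have hG : ∑ x, ∑ x', (κ * τ x * (κ * τ x')).trace.re ≤ S.trace.re := by
    have h1 := re_trace_weighted_le (c := 1) hκh hκξ hSp (by rwa [one_smul])
    rw [one_mul] at h1
    refine le_trans (le_of_eq ?_) h1
    rw [hS]
    simp only [Finset.mul_sum, Finset.sum_mul, Matrix.trace_sum, Complex.re_sum]
    exact Finset.sum_comm
  have hD : ∑ x, (κ * τ x * (κ * τ x)).trace.re ≤ c * S.trace.re := by
    rw [hS, Matrix.trace_sum, Complex.re_sum, Finset.mul_sum]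
    exact Finset.sum_le_sum fun x _ => re_trace_weighted_le hκh hκξ (hτ x) (hc x)
  have hsum : ∑ x, ∑ x', (∑ z, ∑ y, defectCoeff h z y x * defectCoeff h z y x')
      * (κ * τ x * (κ * τ x')).trace.re ≤
      (Fintype.card Y : ℝ)⁻¹ * ((δ - 1) / Fintype.card Z * S.trace.re + c * S.trace.re) := by
    -- Off the diagonal the collision excess is at most `(δ - 1)/|Z|`. The diagonal pays at most `1`
    -- more, so the first bound can be used for all pairs; the weights are nonnegative by `hg`.
    have hle : ∀ x x', (∑ z, ∑ y, defectCoeff h z y x * defectCoeff h z y x')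
        * (κ * τ x * (κ * τ x')).trace.re ≤ (Fintype.card Y : ℝ)⁻¹ *
          ((δ - 1) / Fintype.card Z * (κ * τ x * (κ * τ x')).trace.re
            + if x = x' then (κ * τ x * (κ * τ x')).trace.re else 0) := by
      intro x x'
      rw [sum_defectCoeff_mul, mul_assoc]
      refine mul_le_mul_of_nonneg_left ?_ (by positivity)
      have hx := hg x x'
      have hδ : 0 ≤ (δ - 1) / Fintype.card Z := div_nonneg (by linarith [hh.1]) hZ.le
      by_cases hxx : x = x'
      · rw [if_pos hxx, ← add_one_mul]
        refine mul_le_mul_of_nonneg_right ?_ hx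
        have h1 : ((Finset.univ.filter fun y => h y x = h y x').card : ℝ) / Fintype.card Y ≤ 1 :=
          div_le_one_of_le₀ (by exact_mod_cast Finset.card_le_univ _) hY.le
        have h2 : 0 ≤ (Fintype.card Z : ℝ)⁻¹ := by positivity
        linarith
      · rw [if_neg hxx, add_zero]
        refine mul_le_mul_of_nonneg_right ?_ hx
        rw [sub_div, ← one_div]
        linarith [hh.2 x x' hxx]
    refine (Finset.sum_le_sum fun x _ => Finset.sum_le_sum fun x' _ => hle x x').trans ?_
    simp only [← Finset.mul_sum, Finset.sum_add_distrib, Finset.sum_ite_eq, Finset.mem_univ,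
      if_true]
    refine mul_le_mul_of_nonneg_left (add_le_add (mul_le_mul_of_nonneg_left hG
      (div_nonneg (by linarith [hh.1]) hZ.le)) hD) (by positivity)
  have hξ0 := re_trace_nonneg hξ.posSemidef
  refine base.trans ((mul_le_mul_of_nonneg_left hsum (by positivity)).trans (le_of_eq ?_))
  field_simp

end Hash

/-! ### Choice of the reference operator. -/

section StateBound

variable {X Y Z E : Type*} [Fintype X] [DecidableEq X] [Fintype Y] [DecidableEq Y]
  [Fintype Z] [DecidableEq Z] [Fintype E] [DecidableEq E] [Nonempty Y] [Nonempty Z]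

/-- Takes `ξ = ∑ x, τ x + s • σ`. The first summand gives `∑ x, τ x ≤ ξ`, the second `τ x ≤ t • σ ≤
(t / s) • ξ`. -/
lemma IsContraction.re_trace_mul_extractorDefect_sq_le_of_posDef
    {T : Matrix (Z × Y × E) (Z × Y × E) ℂ}
    (hT : IsContraction T) {h : Y → X → Z} {δ : ℝ} (hh : IsAlmostTwoUniversal δ h)
    {τ : X → Matrix E E ℂ} (hτ : ∀ x, (τ x).PosSemidef) (htr : (∑ x, τ x).trace.re ≤ 1)
    {σ : Matrix E E ℂ} (hσ : σ.PosDef) {s t : ℝ} (hs : 0 < s) (ht : 0 ≤ t)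
    (hle : ∀ x, (t • σ - τ x).PosSemidef) :
    (T * extractorDefect h τ).trace.re ^ 2 ≤
      (1 + s * σ.trace.re) * (δ - 1 + Fintype.card Z * (t / s)) := by
  have hS : (∑ x, τ x).PosSemidef := Matrix.posSemidef_sum _ fun x _ => hτ x
  have hc : ∀ x, ((t / s) • ((∑ x, τ x) + s • σ) - τ x).PosSemidef := fun x => by
    have := (hS.smul (div_nonneg ht hs.le)).add (hle x)
    rwa [smul_add, smul_smul, div_mul_cancel₀ _ hs.ne', add_sub_assoc]
  have hE : ((∑ x, τ x) + s • σ - ∑ x, τ x).PosSemidef := by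
    rw [add_sub_cancel_left]; exact hσ.posSemidef.smul hs.le
  refine (hT.re_trace_mul_extractorDefect_sq_le hh hτ ((hσ.smul hs).posSemidef_add hS) hc
    hE).trans ?_
  have h1 : 0 ≤ δ - 1 + Fintype.card Z * (t / s) := by
    have := hh.1
    have : 0 ≤ Fintype.card Z * (t / s) := by positivity
    linarith
  have h2 := re_trace_nonneg hS
  have h3 := re_trace_nonneg hσ.posSemidef
  rw [Matrix.trace_add, Matrix.trace_smul, Complex.add_re, Complex.smul_re, smul_eq_mul]
  refine mul_le_mul (by linarith) (mul_le_of_le_one_right h1 htr) (mul_nonneg h1 h2) (by positivity)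

/-- A singular `σ` is perturbed to `σ + η • 1`, and `η` tends to `0` from above. -/
lemma IsContraction.re_trace_mul_extractorDefect_sq_le_of_isState
    {T : Matrix (Z × Y × E) (Z × Y × E) ℂ}
    (hT : IsContraction T) {h : Y → X → Z} {δ : ℝ} (hh : IsAlmostTwoUniversal δ h)
    {τ : X → Matrix E E ℂ} (hτ : ∀ x, (τ x).PosSemidef) (htr : (∑ x, τ x).trace.re ≤ 1)
    {σ : Matrix E E ℂ} (hσ : IsState σ) {s t : ℝ} (hs : 0 < s) (ht : 0 ≤ t)
    (hle : ∀ x, (t • σ - τ x).PosSemidef) :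
    (T * extractorDefect h τ).trace.re ^ 2 ≤
      (1 + s) * (δ - 1 + Fintype.card Z * (t / s)) := by
  have key : ∀ η ∈ Set.Ioi (0 : ℝ), (T * extractorDefect h τ).trace.re ^ 2 ≤
      (1 + s * (1 + η * Fintype.card E)) * (δ - 1 + Fintype.card Z * (t / s)) := by
    intro η hη
    have hη0 : (0 : ℝ) < η := hη
    have h1 : (η • (1 : Matrix E E ℂ)).PosDef := Matrix.PosDef.one.smul hη0
    have h2 := hT.re_trace_mul_extractorDefect_sq_le_of_posDef hh hτ htr
      (h1.posSemidef_add hσ.1) hs ht fun x => by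
        have := (hle x).add (h1.posSemidef.smul ht)
        rwa [smul_add, add_sub_right_comm]
    rwa [Matrix.trace_add, Matrix.trace_smul, Matrix.trace_one, hσ.2, Complex.add_re,
      Complex.smul_re, Complex.one_re, Complex.natCast_re, smul_eq_mul] at h2
  have hlim : Filter.Tendsto (fun η : ℝ => (1 + s * (1 + η * Fintype.card E)) *
      (δ - 1 + Fintype.card Z * (t / s))) (nhdsWithin 0 (Set.Ioi 0))
      (nhds ((1 + s * (1 + 0 * Fintype.card E)) * (δ - 1 + Fintype.card Z * (t / s)))) :=
    (Continuous.tendsto (by fun_prop) 0).mono_left nhdsWithin_le_nhds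
  have := ge_of_tendsto hlim (Filter.eventually_of_mem self_mem_nhdsWithin key)
  simpa using this

end StateBound

/-! ### Diagonal blocks and classical-quantum operators. -/

section Blocks

variable {X E : Type*}

/-- The block of a bipartite operator at the classical value `x`. -/
def block (M : Matrix (X × E) (X × E) ℂ) (x : X) : Matrix E E ℂ :=
  M.submatrix (Prod.mk x) (Prod.mk x)

variable [Fintype X] [DecidableEq X]

lemma cqState_apply (f : X → Matrix E E ℂ) (x x' : X) (e e' : E) :
    cqState f (x, e) (x', e') = if x = x' then f x e e' else 0 := by
  simp only [cqState, Matrix.sum_apply, Matrix.kronecker, Matrix.kroneckerMap_apply, proj,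
    Matrix.single_apply, ite_and, ite_mul, one_mul, zero_mul, Finset.sum_ite_eq', Finset.mem_univ,
    if_true]

lemma block_cqState (f : X → Matrix E E ℂ) : block (cqState f) = f := by
  ext x e e'
  simp [block, cqState_apply]

lemma cqState_one [DecidableEq E] : cqState (fun _ : X => (1 : Matrix E E ℂ)) = 1 := by
  ext ⟨x, e⟩ ⟨x', e'⟩
  by_cases hx : x = x' <;> simp [cqState_apply, Matrix.one_apply, hx]

lemma cqState_add (f g : X → Matrix E E ℂ) :
    cqState (fun x => f x + g x) = cqState f + cqState g := by
  ext ⟨x, e⟩ ⟨x', e'⟩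
  by_cases hx : x = x' <;> simp [cqState_apply, hx]

lemma cqState_sub (f g : X → Matrix E E ℂ) :
    cqState (fun x => f x - g x) = cqState f - cqState g := by
  ext ⟨x, e⟩ ⟨x', e'⟩
  by_cases hx : x = x' <;> simp [cqState_apply, hx]

variable [Fintype E]

lemma posSemidef_cqState {f : X → Matrix E E ℂ} (hf : ∀ x, (f x).PosSemidef) :
    (cqState f).PosSemidef := by
  refine Matrix.posSemidef_sum _ fun x _ => Matrix.PosSemidef.kronecker ?_ (hf x)
  have := Matrix.posSemidef_conjTranspose_mul_self (proj x : Matrix X X ℂ)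
  simpa [proj] using this

lemma isContraction_cqState [DecidableEq E] {f : X → Matrix E E ℂ}
    (hf : ∀ x, IsContraction (f x)) : IsContraction (cqState f) := by
  rw [IsContraction, ← cqState_one, ← cqState_sub, ← cqState_add]
  exact ⟨posSemidef_cqState fun x => (hf x).1, posSemidef_cqState fun x => (hf x).2⟩

lemma trace_cqState_mul (f : X → Matrix E E ℂ) (M : Matrix (X × E) (X × E) ℂ) :
    (cqState f * M).trace = ∑ x, (f x * block M x).trace := by
  simp [Matrix.trace, Matrix.mul_apply, Fintype.sum_prod_type, cqState_apply, block]

omit [DecidableEq X] in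
lemma trace_sum_block (M : Matrix (X × E) (X × E) ℂ) : (∑ x, block M x).trace = M.trace := by
  simp [Matrix.trace, Fintype.sum_prod_type, block, Matrix.sum_apply]
  exact Finset.sum_comm

end Blocks

lemma IsContraction.submatrix {m n : Type*} [DecidableEq m] [DecidableEq n] {T : Matrix n n ℂ}
    (hT : IsContraction T) {f : m → n} (hf : Function.Injective f) :
    IsContraction (T.submatrix f f) := by
  have h1 := hT.1.submatrix f
  have h2 := hT.2.submatrix f
  rw [Matrix.submatrix_sub, Pi.sub_apply, Pi.sub_apply, Matrix.submatrix_one f hf] at h1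
  rw [Matrix.submatrix_add, Pi.add_apply, Pi.add_apply, Matrix.submatrix_one f hf] at h2
  exact ⟨h1, h2⟩

lemma isContraction_sum_smul {ι n : Type*} [Fintype ι] [Fintype n] [DecidableEq n]
    {T : ι → Matrix n n ℂ} (hT : ∀ i, IsContraction (T i)) {a : ι → ℝ} (ha : ∑ i, |a i| ≤ 1) :
    IsContraction (∑ i, a i • T i) := by
  have aux : ∀ b : ι → ℝ, ∑ i, |b i| ≤ 1 → (1 + ∑ i, b i • T i).PosSemidef := by
    intro b hb
    have h1 : (1 + ∑ i, b i • T i) = (1 - ∑ i, |b i|) • (1 : Matrix n n ℂ)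
        + ∑ i, (|b i| • (1 : Matrix n n ℂ) + b i • T i) := by
      rw [Finset.sum_add_distrib, ← Finset.sum_smul, sub_smul, one_smul]; abel
    rw [h1]
    refine (Matrix.PosSemidef.one.smul (sub_nonneg.2 hb)).add
      (Matrix.posSemidef_sum _ fun i _ => ?_)
    rcases le_total 0 (b i) with h | h
    · rw [abs_of_nonneg h, ← smul_add]
      exact (hT i).2.smul h
    · rw [abs_of_nonpos h, show -b i • (1 : Matrix n n ℂ) + b i • T i = (-b i) • (1 - T i) by
        rw [smul_sub, neg_smul, neg_smul, sub_neg_eq_add]]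
      exact (hT i).1.smul (neg_nonneg.2 h)
  refine ⟨?_, aux a ha⟩
  have := aux (fun i => -a i) (by simpa using ha)
  simpa [sub_eq_add_neg] using this

/-! ### Pulling tests back to the source. -/

section Pullback

variable {X Y Z E : Type*} [Fintype X] [DecidableEq X] [Fintype Y] [DecidableEq Y]
  [Fintype Z] [DecidableEq Z] [Fintype E] [DecidableEq E] [Nonempty Y] [Nonempty Z]

omit [Fintype X] [DecidableEq X] [DecidableEq Y] in
-- For each `y`, the indicator and the uniform part each contribute total mass one. Halving makes
-- the pulled-back test a contraction, whence the factor 2 in `IsContraction.exists_pullback`.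
lemma sum_abs_defectCoeff_le (h : Y → X → Z) (x : X) :
    ∑ i : Z × Y, |defectCoeff h i.1 i.2 x / 2| ≤ 1 := by
  have hY : (Fintype.card Y : ℝ) ≠ 0 := by simp
  have hZ : (Fintype.card Z : ℝ) ≠ 0 := by simp
  have hle : ∀ i : Z × Y, |defectCoeff h i.1 i.2 x / 2| ≤ (Fintype.card Y : ℝ)⁻¹ *
      ((if h i.2 x = i.1 then 1 else 0) + (Fintype.card Z : ℝ)⁻¹) / 2 := by
    intro i
    rw [abs_div, abs_two, defectCoeff, abs_mul, abs_of_nonneg (by positivity)]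
    gcongr
    refine (abs_sub _ _).trans (le_of_eq ?_)
    rw [abs_of_nonneg (by split_ifs <;> norm_num), abs_of_nonneg (by positivity)]
  refine (Finset.sum_le_sum fun i _ => hle i).trans (le_of_eq ?_)
  rw [Fintype.sum_prod_type_right]
  simp only [← Finset.sum_div, ← Finset.mul_sum, Finset.sum_add_distrib, Finset.sum_ite_eq,
    Finset.mem_univ, if_true, Finset.sum_const, Finset.card_univ, nsmul_eq_mul]
  field_simp
  norm_num

omit [DecidableEq E] [Nonempty Y] [Nonempty Z] in
lemma trace_mul_kronecker_proj (T : Matrix (Z × Y × E) (Z × Y × E) ℂ) (z : Z) (y : Y)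
    (A : Matrix E E ℂ) :
    (T * Matrix.kronecker (proj z) (Matrix.kronecker (proj y) A)).trace =
      (T.submatrix (fun e => (z, y, e)) (fun e => (z, y, e)) * A).trace := by
  simp only [Matrix.trace, Matrix.diag_apply, Matrix.mul_apply, Fintype.sum_prod_type,
    Matrix.kronecker, Matrix.kroneckerMap_apply, proj, Matrix.single_apply, ite_and, ite_mul,
    one_mul, zero_mul, mul_ite, mul_zero, Finset.sum_ite_eq, Finset.sum_ite_irrel,
    Finset.sum_const_zero, Finset.mem_univ, if_true, Matrix.submatrix_apply]

/-- Testing the extractor defect with a contraction amounts to testing the source with one. -/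
lemma IsContraction.exists_pullback {T : Matrix (Z × Y × E) (Z × Y × E) ℂ}
    (hT : IsContraction T) (h : Y → X → Z) :
    ∃ C : Matrix (X × E) (X × E) ℂ, IsContraction C ∧ ∀ M : Matrix (X × E) (X × E) ℂ,
      (T * extractorDefect h (block M)).trace.re = 2 * (C * M).trace.re := by
  let S : Z × Y → Matrix E E ℂ := fun i =>
    T.submatrix (fun e => (i.1, i.2, e)) (fun e => (i.1, i.2, e))
  -- The adjoint of the map from source to defect, applied to `T` and halved.
  refine ⟨cqState fun x => ∑ i : Z × Y, (defectCoeff h i.1 i.2 x / 2) • S i,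
    isContraction_cqState fun x => isContraction_sum_smul (fun i => hT.submatrix fun a b hab => ?_)
      (sum_abs_defectCoeff_le h x), fun M => ?_⟩
  · simpa using hab
  · rw [trace_cqState_mul, extractorDefect_eq_sum]
    simp only [Finset.mul_sum, Finset.sum_mul, Matrix.trace_sum, trace_mul_kronecker_proj,
      Matrix.mul_smul, Matrix.smul_mul, Matrix.trace_smul, Complex.re_sum, smul_eq_mul,
      Complex.re_ofReal_mul, Complex.smul_re]
    simp only [Fintype.sum_prod_type]
    conv_rhs => rw [Finset.sum_comm]
    refine Finset.sum_congr rfl fun z _ => ?_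
    rw [Finset.sum_comm]
    refine Finset.sum_congr rfl fun x _ => Finset.sum_congr rfl fun y _ => ?_
    ring

end Pullback

/-! ### Smoothing. -/

section SmoothBound

variable {X Y Z E : Type*} [Fintype X] [DecidableEq X] [Fintype Y] [DecidableEq Y]
  [Fintype Z] [DecidableEq Z] [Fintype E] [DecidableEq E] [Nonempty Y] [Nonempty Z]

omit [Fintype X] [Fintype E] [DecidableEq E] in
lemma posSemidef_smul_sub_block {ρ : Matrix (X × E) (X × E) ℂ} {σ : Matrix E E ℂ} {t : ℝ}
    (h : ρ ≤ t • Matrix.kronecker (1 : Matrix X X ℂ) σ) (x : X) :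
    (t • σ - block ρ x).PosSemidef := by
  have h1 := (Matrix.le_iff.1 h).submatrix (Prod.mk x)
  have h2 : t • σ - block ρ x =
      (t • Matrix.kronecker (1 : Matrix X X ℂ) σ - ρ).submatrix (Prod.mk x) (Prod.mk x) := by
    ext e e'
    simp [block]
  rwa [h2]

/-- Leftover hashing for a source close in purified distance to one with large min-entropy. -/
lemma IsContraction.re_trace_mul_extractorDefect_le_sqrt {T : Matrix (Z × Y × E) (Z × Y × E) ℂ}
    (hT : IsContraction T) {h : Y → X → Z} {δ : ℝ} (hh : IsAlmostTwoUniversal δ h)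
    {ρ : X → Matrix E E ℂ} (hρ : IsSubState (cqState ρ)) {ε lam s : ℝ} (hs : 0 < s)
    (hlam : (lam : EReal) < smoothMinEntropy ε (cqState ρ)) :
    (T * extractorDefect h ρ).trace.re ≤
      √((1 + s) * (δ - 1 + Fintype.card Z * ((2 : ℝ) ^ (-lam) / s))) + 4 * ε := by
  -- Strict inequality yields actual witnesses, so no supremum has to be attained.
  simp only [smoothMinEntropy, minEntropy, lt_iSup_iff] at hlam
  obtain ⟨ρ', hρ', hD, σ, hσ, lam', hle, hlt⟩ := hlam
  have hlt' : lam < lam' := EReal.coe_lt_coe_iff.1 hlt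
  obtain ⟨C, hC, hCM⟩ := hT.exists_pullback (E := E) h
  have h1 := hCM (cqState ρ)
  have h2 := hCM ρ'
  rw [block_cqState] at h1
  -- The factor 2 here and the factor 2 of the pullback together give `4 * ε`.
  have h3 := hC.neg.re_trace_mul_sub_le_purifiedDist hρ' hρ
  rw [Matrix.neg_mul, Matrix.trace_neg, Matrix.mul_sub, Matrix.trace_sub, Complex.neg_re,
    Complex.sub_re] at h3
  have h4 := hT.re_trace_mul_extractorDefect_sq_le_of_isState hh (τ := block ρ')
    (fun x => hρ'.1.submatrix (Prod.mk x)) (by rw [trace_sum_block]; exact hρ'.2) hσ hs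
    (Real.rpow_nonneg zero_le_two (-lam')) (posSemidef_smul_sub_block hle)
  have h5 : (1 + s) * (δ - 1 + Fintype.card Z * ((2 : ℝ) ^ (-lam') / s)) ≤
      (1 + s) * (δ - 1 + Fintype.card Z * ((2 : ℝ) ^ (-lam) / s)) := by
    gcongr
    exact one_le_two
  have h6 := Real.abs_le_sqrt (h4.trans h5)
  have h7 := (le_abs_self _).trans h6
  linarith

/-- The endpoint follows by letting `lam` increase to `k`, the bound being continuous in `lam`. -/
lemma IsContraction.re_trace_mul_extractorDefect_le_sqrt_of_le
    {T : Matrix (Z × Y × E) (Z × Y × E) ℂ}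
    (hT : IsContraction T) {h : Y → X → Z} {δ : ℝ} (hh : IsAlmostTwoUniversal δ h)
    {ρ : X → Matrix E E ℂ} (hρ : IsSubState (cqState ρ)) {ε k s : ℝ} (hs : 0 < s)
    (hk : (k : EReal) ≤ smoothMinEntropy ε (cqState ρ)) :
    (T * extractorDefect h ρ).trace.re ≤
      √((1 + s) * (δ - 1 + Fintype.card Z * ((2 : ℝ) ^ (-k) / s))) + 4 * ε := by
  have hcont : Continuous fun lam : ℝ =>
      √((1 + s) * (δ - 1 + Fintype.card Z * ((2 : ℝ) ^ (-lam) / s))) + 4 * ε := by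
    have : Continuous fun lam : ℝ => (2 : ℝ) ^ (-lam) :=
      continuous_const.rpow continuous_neg fun _ => Or.inl two_ne_zero
    fun_prop
  refine ge_of_tendsto ((hcont.tendsto k).mono_left (nhdsWithin_le_nhds (s := Set.Iio k)))
    (Filter.eventually_of_mem self_mem_nhdsWithin fun lam hlam => ?_)
  exact hT.re_trace_mul_extractorDefect_le_sqrt hh hρ hs
    ((EReal.coe_lt_coe_iff.2 hlam).trans_le hk)

lemma IsContraction.re_trace_mul_extractorDefect_le_two {T : Matrix (Z × Y × E) (Z × Y × E) ℂ}
    (hT : IsContraction T) (h : Y → X → Z) {ρ : X → Matrix E E ℂ}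
    (hρ : IsSubState (cqState ρ)) : (T * extractorDefect h ρ).trace.re ≤ 2 := by
  obtain ⟨C, hC, hCM⟩ := hT.exists_pullback (E := E) h
  have h1 := hCM (cqState ρ)
  rw [block_cqState] at h1
  linarith [hC.re_trace_mul_le hρ.1, hρ.2]

omit [DecidableEq X] [Nonempty Y] [Nonempty Z] in
lemma exists_traceNorm_extractorDefect_eq (h : Y → X → Z) {ρ : X → Matrix E E ℂ}
    (hρ : ∀ x, (ρ x).PosSemidef) : ∃ T, IsContraction T ∧
      traceNorm (extractorDefect h ρ) = (T * extractorDefect h ρ).trace.re := by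
  obtain ⟨T, hTh, hTT, hT⟩ := exists_traceNorm_eq
    (isHermitian_extractorDefect h fun x => (hρ x).isHermitian)
  exact ⟨T, isContraction_of_mul_self hTh hTT, hT⟩

end SmoothBound

/-! ### Output length and final estimate. -/

lemma card_mul_rpow_eq {N k a g : ℝ} (hN : 0 < N) (ha : 0 < a) (hg : 0 < g)
    (h : Real.logb 2 N = k - Real.logb 2 a - Real.logb 2 (1 / g)) :
    N * (2 : ℝ) ^ (-k) * a = g := by
  have h1 : Real.logb 2 (N * a / g) = k := by
    rw [Real.logb_div (by positivity) hg.ne', Real.logb_mul hN.ne' ha.ne']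
    rw [one_div, Real.logb_inv] at h
    linarith
  have h2 : (2 : ℝ) ^ k = N * a / g := by
    rw [← h1, Real.rpow_logb two_pos (by norm_num) (by positivity)]
  rw [Real.rpow_neg zero_le_two, h2]
  field_simp

end QExt

theorem mainTheorem3 {X Y Z : Type*} [Fintype X] [DecidableEq X]
    [Fintype Y] [DecidableEq Y] [Nonempty Y] [Fintype Z] [DecidableEq Z] [Nonempty Z]
    (k δ ε' ε'' l : ℝ) (hε' : 0 < ε') (hε'' : 0 < ε'') (hδ : δ < 1 + 4 * ε'' ^ 2)
    (hl : Real.logb 2 (Fintype.card Z : ℝ) = l)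
    (hlk : l = k - Real.logb 2 (1 + 2 / ε' ^ 2) - Real.logb 2 (1 / (4 * ε'' ^ 2 - δ + 1)))
    (h : Y → X → Z) (hh : QExt.IsAlmostTwoUniversal δ h) :
    QExt.IsQuantumProofStrongExtractor k (ε' + ε'') (fun x y => h y x) := by
  intro E _ _ ρ hρ hsub ε hε hk
  obtain ⟨T, hTc, hT⟩ := QExt.exists_traceNorm_extractorDefect_eq h hρ
  change 1 / 2 * QExt.traceNorm (QExt.extractorDefect h ρ) ≤ _
  rw [hT]
  -- For `ε'' ≥ 1` the trivial bound on the trace distance suffices; otherwise `δ - 1 ≤ 4`, as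
  -- needed for `hsqrt`.
  rcases le_total 1 ε'' with h1 | h1
  · linarith [hTc.re_trace_mul_extractorDefect_le_two h hsub]
  have hN : (0 : ℝ) < Fintype.card Z := by exact_mod_cast Fintype.card_pos
  have hcard := QExt.card_mul_rpow_eq hN (by positivity) (by linarith) (hl.trans hlk)
  have hbound := hTc.re_trace_mul_extractorDefect_le_sqrt_of_le hh hsub
    -- With this `s`, `(1 + s) / s = 1 + 2 / ε' ^ 2`, the factor in the length formula.
    (s := ε' ^ 2 / 2) (by positivity) hk
  have heq : (1 + ε' ^ 2 / 2) *
      (δ - 1 + Fintype.card Z * ((2 : ℝ) ^ (-k) / (ε' ^ 2 / 2))) =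
      4 * ε'' ^ 2 + ε' ^ 2 / 2 * (δ - 1) := by
    have h2 : (1 + ε' ^ 2 / 2) * (Fintype.card Z * ((2 : ℝ) ^ (-k) / (ε' ^ 2 / 2))) =
        Fintype.card Z * (2 : ℝ) ^ (-k) * (1 + 2 / ε' ^ 2) := by
      field_simp
      ring
    rw [mul_add, h2, hcard]
    ring
  -- With `δ - 1 ≤ 4` the radicand is at most `4 ε''² + 2 ε'²`, below `4 (ε' + ε'')²`.
  have hsqrt : √(4 * ε'' ^ 2 + ε' ^ 2 / 2 * (δ - 1)) ≤ 2 * (ε' + ε'') := by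
    refine Real.sqrt_le_iff.2 ⟨by positivity, ?_⟩
    have h3 : δ - 1 ≤ 4 := by nlinarith
    have h4 : ε' ^ 2 / 2 * (δ - 1) ≤ ε' ^ 2 / 2 * 4 :=
      mul_le_mul_of_nonneg_left h3 (by positivity)
    nlinarith [mul_pos hε' hε'', sq_nonneg ε']
  rw [heq] at hbound
  linarith
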